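/- Let $\mathbb T=\mathbb R/2\pi\mathbb Z$, let $L^2=L^2(\mathbb T^2;\mathbb C)$, and write $\hat f(k)$, $k=(k_1,k_2)\in\mathbb Z^2$, for the Fourier coefficients of a periodic distribution $f$. Put $\varphi(k)=k_1^3+3k_1k_2^2$ and let $e^{it\varphi(\nabla/i)}$ be the Fourier multiplier with symbol $e^{it\varphi(k)}$, that is, the propagator of $\partial_tu+\partial_x^3u+3\partial_x\partial_y^2u=0$. For dyadic $N\in\{1,2,4,\dots\}$ let $P_N$ be the Fourier multiplier with symbol $1_{[N,2N)}(|k|)$ if $N\ge2$ and $1_{[0,2)}(|k|)$ if $N=1$. For a bounded interval $I=[a,b)$, a $U^2(I)$-atom is a step function $\sum_{k=1}^K\phi_{k-1}\chi_{[t_{k-1},t_k)}$ with $a=t_0<\dots<t_K=b$, $\phi_k\in L^2$ and $\sum_{k}\|\phi_k\|_{L^2}^2=1$, and $$\|f\|_{U^2(I)}=\inf\Big\{\sum_n|\lambda_n| : f=\sum_n\lambda_na_n \text{ pointwise on } I,\ a_n \text{ a } U^2(I)\text{-atom}\Big\}.$$ Moreover $\|f\|_{DU^2(I)}=\|w\|_{U^2(I)}$,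 where $w\in U^2(I)$ satisfies $\partial_tw=f$ in the sense of distributions on $(a,b)$ and $\lim_{t\uparrow b}w(t)=0$. Norms are $\infty$ if there is no such representation or no such $w$. Set $\|f\|_{U^2_\varphi(I)}=\|e^{-it\varphi(\nabla/i)}f\|_{U^2(I)}$ and $\|f\|_{DU^2_\varphi(I)}=\|e^{-it\varphi(\nabla/i)}f\|_{DU^2(I)}$. For $T\in(0,1]$ and $s\ge0$ define $$\|u\|_{F^s_{ZK}(T)}^2=\sum_{N}N^{2s}\sup_I\|P_Nu\|_{U^2_\varphi(I)}^2,\qquad \|f\|_{N^s_{ZK}(T)}^2=\sum_{N}N^{2s}\sup_I\|P_Nf\|_{DU^2_\varphi(I)}^2,$$ where, for each $N$, the supremum runs over the intervals $I=[a,b)\subseteq[0,T)$ of length $\min(N^{-2},T)$. Then for every $s>0$ there is a constant $C=C(s)$ such that for all $T\in(0,1]$ and all $L^2$-valued functions $u,v$ of time $$\|\partial_x(uv)\|_{N^s_{ZK}(T)}\le C\,\|u\|_{F^s_{ZK}(T)}\|v\|_{F^s_{ZK}(T)},\qquad \|\partial_x(uv)\|_{N^0_{ZK}(T)}\le C\,\|u\|_{F^0_{ZK}(T)}\|v\|_{F^s_{ZK}(T)}$$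 (with the convention $0\cdot\infty=0$). Here $\partial_x(uv)(t)$ is the distributional derivative in the first variable of $u(t)v(t)\in L^1(\mathbb T^2)$. -/

import Mathlib

open MeasureTheory Set Filter Topology
open scoped ENNReal NNReal ContDiff

namespace ZK

/-! The torus `𝕋² = (ℝ/2πℤ)²` is parametrized by `UnitAddTorus (Fin 2)` through `x = 2πθ`, so that
the character `x ↦ exp(i k·x)`, `k ∈ ℤ²`, is `UnitAddTorus.mFourier k`, the measure is normalized
Haar measure, and `∂_x`, `φ(∇/i)`, `P_N` are the Fourier multipliers with symbols `i k₁`, `φ(k)`,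
`1_{[N,2N)}(|k|)` in the integer frequency `k`. -/

/-- The Hilbert space `L²(𝕋²; ℂ)` for normalized Haar measure. -/
noncomputable abbrev L2 : Type :=
  Lp ℂ 2 (Measure.pi (fun _ : Fin 2 => (AddCircle.haarAddCircle : Measure UnitAddCircle)))

/-- A periodic distribution, given by its Fourier coefficients. -/
abbrev Coeffs : Type := (Fin 2 → ℤ) → ℂ

/-- The Euclidean length of a frequency `k ∈ ℤ²`. -/
noncomputable def freqNorm (k : Fin 2 → ℤ) : ℝ := Real.sqrt ((k 0 : ℝ) ^ 2 + (k 1 : ℝ) ^ 2)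

/-- The frequencies of the Littlewood–Paley block `N = 2 ^ j`: `N ≤ |k| < 2N` if `j ≥ 1`, and
`|k| < 2` if `j = 0`. -/
def annulus (j : ℕ) : Set (Fin 2 → ℤ) :=
  {k | freqNorm k < 2 ^ (j + 1) ∧ (j = 0 ∨ (2 : ℝ) ^ j ≤ freqNorm k)}

theorem annulus_finite (j : ℕ) : (annulus j).Finite := by
  refine Set.Finite.subset
    (Set.finite_Icc (fun _ : Fin 2 => -(2 : ℤ) ^ (j + 1)) (fun _ => (2 : ℤ) ^ (j + 1))) ?_
  intro k hk
  have h1 := hk.1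
  have key : ∀ i, |(k i : ℝ)| ≤ 2 ^ (j + 1) := by
    intro i
    refine le_trans (Real.abs_le_sqrt ?_) h1.le
    fin_cases i
    · simpa using sq_nonneg (k 1 : ℝ)
    · simpa using sq_nonneg (k 0 : ℝ)
  refine ⟨fun i => ?_, fun i => ?_⟩
  · have := (abs_le.1 (key i)).1
    exact_mod_cast this
  · have := (abs_le.1 (key i)).2
    exact_mod_cast this

/-- The Littlewood–Paley projection `P_N`, `N = 2 ^ j`, of a periodic distribution; it is a
trigonometric polynomial. -/
noncomputable def lpProj (j : ℕ) (c : Coeffs) : L2 :=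
  ∑ k ∈ (annulus_finite j).toFinset, c k • UnitAddTorus.mFourierLp 2 k

/-- The Zakharov–Kuznetsov dispersion relation `φ(k) = k₁³ + 3 k₁ k₂²`. -/
noncomputable def phase (k : Fin 2 → ℤ) : ℝ := (k 0 : ℝ) ^ 3 + 3 * (k 0 : ℝ) * (k 1 : ℝ) ^ 2

theorem memlp_phase (t : ℝ) (f : L2) :
    Memℓp (fun k => Complex.exp (Complex.I * ((t * phase k : ℝ) : ℂ)) *
      UnitAddTorus.mFourierBasis.repr f k) 2 := by
  refine (lp.memℓp (UnitAddTorus.mFourierBasis.repr f)).mono' fun k => ?_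
  rw [norm_mul, mul_comm Complex.I, Complex.norm_exp_ofReal_mul_I, one_mul]

/-- The propagator `exp(i t φ(∇/i))` on `L²(𝕋²)`; it solves `∂_t u + ∂_x³ u + 3 ∂_x ∂_y² u = 0`. -/
noncomputable def propagator (t : ℝ) (f : L2) : L2 :=
  UnitAddTorus.mFourierBasis.repr.symm
    ⟨fun k => Complex.exp (Complex.I * ((t * phase k : ℝ) : ℂ)) *
      UnitAddTorus.mFourierBasis.repr f k, memlp_phase t f⟩

/-- `f` is a `U²([a,b))`-atom: a step function along a partition `a = t₀ < ⋯ < t_K = b` whose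
values `φ₀, …, φ_{K-1}` in `L²` satisfy `∑ ‖φ_k‖² = 1`. -/
def IsAtom (a b : ℝ) (f : ℝ → L2) : Prop :=
  ∃ (K : ℕ) (t : ℕ → ℝ) (φ : ℕ → L2),
    t 0 = a ∧ t K = b ∧ (∀ k < K, t k < t (k + 1)) ∧
    ∑ k ∈ Finset.range K, ‖φ k‖ ^ 2 = 1 ∧
    ∀ x ∈ Ico a b, f x = ∑ k ∈ Finset.range K, (Ico (t k) (t (k + 1))).indicator (fun _ => φ k) x

/-- The `U²([a,b))`-norm (with value `∞` if `f ∉ U²`). -/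
noncomputable def normU2 (a b : ℝ) (f : ℝ → L2) : ℝ≥0∞ :=
  ⨅ (l : ℕ → ℂ) (A : ℕ → ℝ → L2) (_ : ∀ n, IsAtom a b (A n))
    (_ : ∀ x ∈ Ico a b, HasSum (fun n => l n • A n x) (f x)), ∑' n, ‖l n‖ₑ

/-- `∂_t w = f` on `(a,b)` in the sense of `L²(𝕋²)`-valued distributions. -/
def HasWeakTimeDeriv (a b : ℝ) (w f : ℝ → L2) : Prop :=
  LocallyIntegrableOn w (Ioo a b) ∧ LocallyIntegrableOn f (Ioo a b) ∧
  ∀ ψ : ℝ → ℂ, ContDiff ℝ ∞ ψ → HasCompactSupport ψ → tsupport ψ ⊆ Ioo a b →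
    ∫ x, deriv ψ x • w x = - ∫ x, ψ x • f x

/-- The `DU²([a,b))`-norm: the `U²`-norm of the primitive of `f` whose limit at the right endpoint
`b` is zero (with value `∞` if there is no such primitive in `U²`). -/
noncomputable def normDU2 (a b : ℝ) (f : ℝ → L2) : ℝ≥0∞ :=
  ⨅ (w : ℝ → L2) (_ : Tendsto w (𝓝[<] b) (𝓝 0)) (_ : HasWeakTimeDeriv a b w f), normU2 a b w

/-- The norm of `U²_φ([a,b); L²)`. -/
noncomputable def normU2ZK (a b : ℝ) (f : ℝ → L2) : ℝ≥0∞ :=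
  normU2 a b (fun t => propagator (-t) (f t))

/-- The norm of `DU²_φ([a,b); L²)`. -/
noncomputable def normDU2ZK (a b : ℝ) (f : ℝ → L2) : ℝ≥0∞ :=
  normDU2 a b (fun t => propagator (-t) (f t))

/-- The length `min(N⁻², T)`, `N = 2 ^ j`, of the time windows within `[0,T)` for frequencies `N`. -/
noncomputable def window (T : ℝ) (j : ℕ) : ℝ := min (((2 : ℝ) ^ j) ^ (-2 : ℤ)) T

/-- The short-time norm `(∑_N N^{2s} sup_I ‖P_N f‖²_{X(I)})^{1/2}`, `N = 2 ^ j`, where `I` runs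
through the intervals `[a,b) ⊆ [0,T)` of length `min(N⁻², T)` and `X` is a scale of norms on
`L²`-valued functions on `[a,b)`. -/
noncomputable def shortTimeNorm (X : ℝ → ℝ → (ℝ → L2) → ℝ≥0∞) (T s : ℝ) (f : ℝ → Coeffs) : ℝ≥0∞ :=
  (∑' j : ℕ, ENNReal.ofReal (((2 : ℝ) ^ j) ^ (2 * s)) *
    (⨆ (a : ℝ) (_ : 0 ≤ a) (_ : a + window T j ≤ T),
      X a (a + window T j) (fun t => lpProj j (f t))) ^ 2) ^ (1 / 2 : ℝ)

/-- The norm of `F^s_{ZK}(T)`. -/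
noncomputable def normF (T s : ℝ) (u : ℝ → L2) : ℝ≥0∞ :=
  shortTimeNorm normU2ZK T s (fun t => UnitAddTorus.mFourierCoeff (u t))

/-- The norm of `N^s_{ZK}(T)`. -/
noncomputable def normN (T s : ℝ) (f : ℝ → Coeffs) : ℝ≥0∞ :=
  shortTimeNorm normDU2ZK T s f

/-- The distribution `∂_x (g h)` for `g, h ∈ L²(𝕋²)`: here `g h ∈ L¹(𝕋²)`, and the `k`-th Fourier
coefficient of its distributional derivative is `i k₁` times that of `g h`. -/
noncomputable def dxMul (g h : L2) : Coeffs := fun k =>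
  Complex.I * (k 0 : ℂ) * UnitAddTorus.mFourierCoeff (fun x => g x * h x) k

end ZK

/-!
No dispersion is needed. On a window of length `N⁻²` a primitive in time of `P_N ∂_x (u v)` is
Lipschitz, and Lipschitz functions lie in `U²`: interpolation on the grid with `4 ^ n` cells changes
by `O(4 ^ (-n))` from one grid to the next, hence by `O(2 ^ (-n))` in `U²`. So the `DU²`-norm is at
most the length of the window times the supremum in time of the `L²`-norm, and the factor `N⁻²`
absorbs both the derivative and Bernstein's inequality from `ℓ^∞` to `ℓ²` in the frequencies of size
`N`, each of which costs a factor `N`.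

A Fourier coefficient of `u v` is a convolution, which the Cauchy–Schwarz inequality bounds by
products of `L²`-norms. At a frequency of size `N`, either `v` has frequency `≳ N`, and the sum over
`N` is a geometric series because `s > 0`, or the frequency of `v` is `≪ N`, and that of `u` is
comparable to `N`.
-/

namespace ZK

section StepFunctions

variable {E : Type*}

theorem pairwiseDisjoint_Ico_of_lt_succ {α : Type*} [LinearOrder α] {K : ℕ} {t : ℕ → α}
    (ht : ∀ k < K, t k < t (k + 1)) :
    (Finset.range K : Set ℕ).PairwiseDisjoint fun k => Ico (t k) (t (k + 1)) := by
  have hmono : Monotone fun k => t (min k K) := monotone_nat_of_le_succ fun k => by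
    rcases lt_or_ge k K with hk | hk
    · rw [min_eq_left hk.le, min_eq_left (Nat.succ_le_of_lt hk)]
      exact (ht k hk).le
    · rw [min_eq_right hk, min_eq_right (hk.trans k.le_succ)]
  intro i hi j hj hij
  have hiK : i + 1 ≤ K := by simpa using hi
  have hjK : j + 1 ≤ K := by simpa using hj
  simpa only [Function.onFun, Order.succ_eq_add_one, min_eq_left hiK, min_eq_left hjK,
    min_eq_left (i.le_succ.trans hiK), min_eq_left (j.le_succ.trans hjK)]
    using hmono.pairwise_disjoint_on_Ico_succ hij

theorem sum_indicator_const_of_mem {ι α : Type*} [AddCommMonoid E] {I : Finset ι} {s : ι → Set α}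
    (hs : (I : Set ι).PairwiseDisjoint s) (φ : ι → E) {i : ι} (hi : i ∈ I) {x : α} (hx : x ∈ s i) :
    ∑ j ∈ I, (s j).indicator (fun _ => φ j) x = φ i := by
  rw [Finset.sum_eq_single_of_mem i hi fun j hj hji =>
    indicator_of_notMem (fun hxj => hji (hs.elim_set hj hi x hxj hx)) _, indicator_of_mem hx]

/-- The largest point of the grid `a, a + h, a + 2h, …` that does not exceed `x`, for `x ≥ a`. -/
noncomputable def gridFloor (a h x : ℝ) : ℝ := a + ⌊(x - a) / h⌋₊ * h

variable {a b h x : ℝ}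

theorem le_gridFloor (hh : 0 < h) (x : ℝ) : a ≤ gridFloor a h x :=
  le_add_of_nonneg_right (by positivity)

theorem gridFloor_le (hh : 0 < h) (hx : a ≤ x) : gridFloor a h x ≤ x := by
  have := (le_div_iff₀ hh).1 (Nat.floor_le (div_nonneg (sub_nonneg.2 hx) hh.le))
  rw [gridFloor]
  linarith

theorem lt_gridFloor_add (hh : 0 < h) (x : ℝ) : x < gridFloor a h x + h := by
  have := (div_lt_iff₀ hh).1 (Nat.lt_floor_add_one ((x - a) / h))
  rw [gridFloor]
  linarith

theorem gridFloor_mem_Ico (hh : 0 < h) (hx : x ∈ Ico a b) : gridFloor a h x ∈ Ico a b :=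
  ⟨le_gridFloor hh x, (gridFloor_le hh hx.1).trans_lt hx.2⟩

theorem gridFloor_natCast_mul_gridFloor (hh : h ≠ 0) (m : ℕ) (x : ℝ) :
    gridFloor a (m * h) (gridFloor a h x) = gridFloor a (m * h) x := by
  simp only [gridFloor, add_sub_cancel_left, mul_div_mul_right _ _ hh, Nat.floor_div_eq_div,
    ← Nat.floor_div_natCast, div_div, mul_comm h (m : ℝ)]

theorem gridFloor_gridFloor_div_pow (a : ℝ) {m n : ℕ} (hmn : m ≤ n) (x : ℝ) :
    gridFloor a (h / 4 ^ m) (gridFloor a (h / 4 ^ n) x) = gridFloor a (h / 4 ^ m) x := by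
  rcases eq_or_ne h 0 with rfl | hh
  · simp [gridFloor]
  · obtain ⟨i, rfl⟩ := Nat.exists_eq_add_of_le hmn
    have hmesh : h / 4 ^ m = (4 ^ i : ℕ) * (h / 4 ^ (m + i)) := by
      push_cast
      field_simp
      ring
    rw [hmesh, gridFloor_natCast_mul_gridFloor (by positivity)]

theorem tendsto_gridFloor (hh : 0 < h) (hx : a ≤ x) :
    Tendsto (fun n : ℕ => gridFloor a (h / 4 ^ n) x) atTop (𝓝 x) := by
  have hmesh : Tendsto (fun n : ℕ => x - h / 4 ^ n) atTop (𝓝 x) := by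
    simpa using (tendsto_const_nhds.div_atTop
      (tendsto_pow_atTop_atTop_of_one_lt (by norm_num : (1 : ℝ) < 4))).const_sub x
  exact tendsto_of_tendsto_of_tendsto_of_le_of_le hmesh tendsto_const_nhds
    (fun n => (sub_lt_iff_lt_add.2 (lt_gridFloor_add (by positivity) x)).le)
    fun n => gridFloor_le (by positivity) hx

/-- The step functions interpolating `w` on the grids of `[a, b)` with `4 ^ n` cells, preceded by
the zero function so that the increments sum to `w`. -/
noncomputable def gridApprox [Zero E] (a b : ℝ) (w : ℝ → E) : ℕ → ℝ → E
  | 0 => 0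
  | n + 1 => fun x => w (gridFloor a ((b - a) / 4 ^ n) x)

theorem gridApprox_apply_gridFloor [Zero E] (w : ℝ → E) {m n : ℕ} (hmn : m ≤ n + 1) (x : ℝ) :
    gridApprox a b w m (gridFloor a ((b - a) / 4 ^ n) x) = gridApprox a b w m x := by
  cases m with
  | zero => rfl
  | succ m => exact congrArg w (gridFloor_gridFloor_div_pow a (Nat.le_of_succ_le_succ hmn) x)

theorem tendsto_gridApprox [Zero E] [TopologicalSpace E] {w : ℝ → E} (hw : ContinuousOn w (Ico a b))
    (hx : x ∈ Ico a b) : Tendsto (fun n => gridApprox a b w n x) atTop (𝓝 (w x)) := by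
  have hL : 0 < b - a := sub_pos.2 (hx.1.trans_lt hx.2)
  exact (tendsto_add_atTop_iff_nat 1).1 <| (hw x hx).tendsto.comp <|
    tendsto_nhdsWithin_iff.2 ⟨tendsto_gridFloor hL hx.1,
      Eventually.of_forall fun n => gridFloor_mem_Ico (by positivity) hx⟩

theorem norm_gridApprox_succ_sub_le [NormedAddCommGroup E] (hab : a < b) {w : ℝ → E} {K : ℝ≥0}
    (hb : w b = 0) (hw : LipschitzOnWith K w (Icc a b)) (hx : x ∈ Ico a b) (n : ℕ) :
    ‖gridApprox a b w (n + 1) x - gridApprox a b w n x‖ ≤ K * (4 * (b - a) / 4 ^ n) := by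
  have _ : 0 < b - a := sub_pos.2 hab
  have hmem : ∀ i, gridFloor a ((b - a) / 4 ^ i) x ∈ Icc a b := fun i =>
    Ico_subset_Icc_self (gridFloor_mem_Ico (by positivity) hx)
  cases n with
  | zero =>
    have hlip := hw.norm_sub_le (hmem 0) (right_mem_Icc.2 hab.le)
    rw [hb, Real.norm_eq_abs, abs_of_nonpos (by linarith [(hmem 0).2])] at hlip
    refine le_trans (by simpa only [gridApprox, Pi.zero_apply] using hlip) ?_
    gcongr
    linarith [(hmem 0).1]
  | succ n =>
    have hdist : |gridFloor a ((b - a) / 4 ^ (n + 1)) x - gridFloor a ((b - a) / 4 ^ n) x| ≤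
        (b - a) / 4 ^ n := by
      have hnested : gridFloor a ((b - a) / 4 ^ n) x ≤ gridFloor a ((b - a) / 4 ^ (n + 1)) x := by
        rw [← gridFloor_gridFloor_div_pow a (Nat.le_succ n)]
        exact gridFloor_le (by positivity) (hmem _).1
      have hfine := gridFloor_le (h := (b - a) / 4 ^ (n + 1)) (by positivity) hx.1
      have hcoarse := lt_gridFloor_add (a := a) (h := (b - a) / 4 ^ n) (by positivity) x
      rw [abs_of_nonneg (sub_nonneg.2 hnested)]
      linarith
    calc ‖gridApprox a b w (n + 2) x - gridApprox a b w (n + 1) x‖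
        ≤ K * |gridFloor a ((b - a) / 4 ^ (n + 1)) x - gridFloor a ((b - a) / 4 ^ n) x| :=
          hw.norm_sub_le (hmem _) (hmem _)
      _ ≤ K * ((b - a) / 4 ^ n) := by gcongr
      _ = K * (4 * (b - a) / 4 ^ (n + 1)) := by rw [pow_succ', mul_div_mul_left _ _ four_ne_zero]

end StepFunctions

section USquared

variable {a b : ℝ}

theorem IsAtom.norm_le {A : ℝ → L2} (hA : IsAtom a b A) {x : ℝ} (hx : x ∈ Ico a b) :
    ‖A x‖ ≤ 1 := by
  obtain ⟨K, t, φ, -, -, ht, hφ, hAφ⟩ := hA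
  rw [hAφ x hx]
  by_cases hcell : ∃ k ∈ Finset.range K, x ∈ Ico (t k) (t (k + 1))
  · obtain ⟨k, hk, hxk⟩ := hcell
    rw [sum_indicator_const_of_mem (pairwiseDisjoint_Ico_of_lt_succ ht) φ hk hxk,
      ← sq_le_one_iff₀ (norm_nonneg _)]
    exact (Finset.single_le_sum (f := fun k => ‖φ k‖ ^ 2) (fun _ _ => by positivity) hk).trans_eq hφ
  · push Not at hcell
    rw [Finset.sum_eq_zero fun k hk => indicator_of_notMem (hcell k hk) _, norm_zero]
    exact zero_le_one

theorem IsAtom.aestronglyMeasurable {A : ℝ → L2} (hA : IsAtom a b A) :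
    AEStronglyMeasurable A (volume.restrict (Ico a b)) := by
  obtain ⟨K, t, φ, -, -, -, -, hAφ⟩ := hA
  exact (Finset.aestronglyMeasurable_fun_sum _ fun k _ =>
    (stronglyMeasurable_const.indicator measurableSet_Ico).aestronglyMeasurable).congr
      (ae_restrict_of_forall_mem measurableSet_Ico fun x hx => (hAφ x hx).symm)

theorem normU2_le_tsum {f : ℝ → L2} {l : ℕ → ℂ} {A : ℕ → ℝ → L2} (hA : ∀ n, IsAtom a b (A n))
    (hf : ∀ x ∈ Ico a b, HasSum (fun n => l n • A n x) (f x)) : normU2 a b f ≤ ∑' n, ‖l n‖ₑ :=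
  iInf₂_le_of_le l A (iInf₂_le hA hf)

theorem enorm_le_normU2 {x : ℝ} (hx : x ∈ Ico a b) (f : ℝ → L2) : ‖f x‖ₑ ≤ normU2 a b f := by
  refine le_iInf fun l => le_iInf fun A => le_iInf fun hA => le_iInf fun hf => ?_
  calc ‖f x‖ₑ = ‖∑' n, l n • A n x‖ₑ := by rw [(hf x hx).tsum_eq]
    _ ≤ ∑' n, ‖l n • A n x‖ₑ := enorm_tsum_le_tsum_enorm
    _ ≤ ∑' n, ‖l n‖ₑ := ENNReal.tsum_le_tsum fun n => by
      rw [enorm_smul, ← ofReal_norm (A n x)]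
      exact mul_le_of_le_one_right' (ENNReal.ofReal_le_one.2 ((hA n).norm_le hx))

theorem aestronglyMeasurable_of_normU2_ne_top {f : ℝ → L2} (hf : normU2 a b f ≠ ⊤) :
    AEStronglyMeasurable f (volume.restrict (Ico a b)) := by
  obtain ⟨l, A, hA, hsum, -⟩ : ∃ (l : ℕ → ℂ) (A : ℕ → ℝ → L2), (∀ n, IsAtom a b (A n)) ∧
      (∀ x ∈ Ico a b, HasSum (fun n => l n • A n x) (f x)) ∧ ∑' n, ‖l n‖ₑ < ⊤ := by
    simpa only [normU2, iInf_lt_iff, exists_prop] using lt_top_iff_ne_top.2 hf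
  exact aestronglyMeasurable_of_tendsto_ae atTop
    (fun N => Finset.aestronglyMeasurable_fun_sum (Finset.range N) fun n _ =>
      ((hA n).aestronglyMeasurable.const_smul (l n) :))
    (ae_restrict_of_forall_mem measurableSet_Ico fun x hx => (hsum x hx).tendsto_sum_nat)

theorem exists_sum_norm_sq_eq_one_and_smul_eq {ι E : Type*} [NormedAddCommGroup E]
    [NormedSpace ℂ E] [Nontrivial E] {I : Finset ι} (hI : I.Nonempty) (φ : ι → E) :
    ∃ ψ : ι → E, ∑ i ∈ I, ‖ψ i‖ ^ 2 = 1 ∧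
      ∀ i ∈ I, (√(∑ i ∈ I, ‖φ i‖ ^ 2) : ℂ) • ψ i = φ i := by
  classical
  set S := ∑ i ∈ I, ‖φ i‖ ^ 2 with hS
  have hS0 : 0 ≤ S := Finset.sum_nonneg fun _ _ => by positivity
  rcases hS0.eq_or_lt with hzero | hpos
  · obtain ⟨e, he⟩ := exists_norm_eq E zero_le_one
    obtain ⟨i₀, hi₀⟩ := hI
    refine ⟨Pi.single i₀ e, ?_, fun i hi => ?_⟩
    · rw [Finset.sum_eq_single_of_mem i₀ hi₀ fun i _ hi => by simp [hi]]
      simp [he]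
    · have hφi := (Finset.sum_eq_zero_iff_of_nonneg fun _ _ => by positivity).1 hzero.symm i hi
      rw [← hzero, norm_eq_zero.1 (pow_eq_zero_iff two_ne_zero |>.1 hφi)]
      simp
  · refine ⟨fun i => (√S : ℂ)⁻¹ • φ i, ?_, fun i _ => smul_inv_smul₀ ?_ _⟩
    · simp only [norm_smul, norm_inv, Complex.norm_real, Real.norm_eq_abs, mul_pow, inv_pow, sq_abs,
        Real.sq_sqrt hS0, ← Finset.mul_sum, ← hS]
      exact inv_mul_cancel₀ hpos.ne'
    · exact_mod_cast (Real.sqrt_pos.2 hpos).ne'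

instance : Nontrivial L2 :=
  ⟨UnitAddTorus.mFourierLp 2 0, 0, UnitAddTorus.orthonormal_mFourier.ne_zero 0⟩

theorem exists_isAtom_smul_eq_of_gridFloor (hab : a < b) {p : ℕ} (hp : 0 < p) {g : ℝ → L2} {B : ℝ}
    (hB : 0 ≤ B) (hgB : ∀ x ∈ Ico a b, ‖g x‖ ≤ B)
    (hg : ∀ x ∈ Ico a b, g (gridFloor a ((b - a) / p) x) = g x) :
    ∃ (l : ℂ) (A : ℝ → L2), IsAtom a b A ∧ ‖l‖ ≤ √p * B ∧ ∀ x ∈ Ico a b, l • A x = g x := by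
  have hp' : (0 : ℝ) < p := Nat.cast_pos.2 hp
  have hh : 0 < (b - a) / p := div_pos (sub_pos.2 hab) hp'
  set t : ℕ → ℝ := fun k => a + k * ((b - a) / p) with ht
  have hlast : t p = b := by simp only [ht]; field_simp; ring
  have hstep : ∀ k, t k < t (k + 1) := fun k => by simp only [ht]; push_cast; linarith
  have hmem : ∀ k ∈ Finset.range p, t k ∈ Ico a b := fun k hk =>
    ⟨le_add_of_nonneg_right (by positivity),
      hlast ▸ strictMono_nat_of_lt_succ hstep (Finset.mem_range.1 hk)⟩
  obtain ⟨ψ, hψ, hψg⟩ := exists_sum_norm_sq_eq_one_and_smul_eq (Finset.nonempty_range_iff.2 hp.ne')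
    (fun k => g (t k))
  refine ⟨√(∑ k ∈ Finset.range p, ‖g (t k)‖ ^ 2),
    fun x => ∑ k ∈ Finset.range p, (Ico (t k) (t (k + 1))).indicator (fun _ => ψ k) x,
    ⟨p, t, ψ, by simp [ht], hlast, fun k _ => hstep k, hψ, fun _ _ => rfl⟩, ?_, fun x hx => ?_⟩
  · rw [Complex.norm_real, Real.norm_of_nonneg (Real.sqrt_nonneg _),
      Real.sqrt_le_left (by positivity), mul_pow, Real.sq_sqrt hp'.le]
    exact (Finset.sum_le_card_nsmul _ _ (B ^ 2) fun k hk => by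
      gcongr; exact hgB _ (hmem k hk)).trans_eq (by simp)
  · set k := ⌊(x - a) / ((b - a) / p)⌋₊
    have hxt : x ∈ Ico (t k) (t (k + 1)) :=
      ⟨gridFloor_le hh hx.1, (lt_gridFloor_add (a := a) hh x).trans_eq (by
        simp only [gridFloor, ht]; push_cast; ring)⟩
    have hk : k ∈ Finset.range p := Finset.mem_range.2 <|
      (strictMono_nat_of_lt_succ hstep).lt_iff_lt.1 <| hxt.1.trans_lt (hlast ▸ hx.2)
    simp only
    rw [sum_indicator_const_of_mem (pairwiseDisjoint_Ico_of_lt_succ fun k _ => hstep k) ψ hk hxt,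
      hψg k hk]
    exact hg x hx

theorem exists_isAtom_smul_eq_gridApprox_succ_sub (hab : a < b) {w : ℝ → L2} {K : ℝ≥0}
    (hb : w b = 0) (hw : LipschitzOnWith K w (Icc a b)) (n : ℕ) :
    ∃ (l : ℂ) (A : ℝ → L2), IsAtom a b A ∧ ‖l‖ ≤ K * (4 * (b - a)) * (1 / 2) ^ n ∧
      ∀ x ∈ Ico a b, l • A x = gridApprox a b w (n + 1) x - gridApprox a b w n x := by
  have hL : 0 < b - a := sub_pos.2 hab
  obtain ⟨l, A, hA, hl, hlA⟩ := exists_isAtom_smul_eq_of_gridFloor hab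
    (pow_pos (zero_lt_four' ℕ) n) (B := K * (4 * (b - a) / 4 ^ n)) (by positivity)
    (fun x hx => norm_gridApprox_succ_sub_le hab hb hw hx n) fun x _ => by
      push_cast
      rw [gridApprox_apply_gridFloor w le_rfl, gridApprox_apply_gridFloor w n.le_succ]
  refine ⟨l, A, hA, hl.trans_eq ?_, hlA⟩
  have hpow : (4 : ℝ) ^ n = 2 ^ n * 2 ^ n := by rw [← mul_pow]; norm_num
  rw [Nat.cast_pow, Nat.cast_ofNat, hpow, Real.sqrt_mul_self (by positivity), div_pow, one_pow]
  field_simp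

theorem normU2_le_of_lipschitzOnWith (hab : a < b) {w : ℝ → L2} {K : ℝ≥0} (hb : w b = 0)
    (hw : LipschitzOnWith K w (Icc a b)) : normU2 a b w ≤ 8 * K * ENNReal.ofReal (b - a) := by
  have _ : 0 < b - a := sub_pos.2 hab
  choose l A hA hl hlA using exists_isAtom_smul_eq_gridApprox_succ_sub hab hb hw
  have hgeom : HasSum (fun n : ℕ => K * (4 * (b - a)) * (1 / 2) ^ n) (K * (4 * (b - a)) * 2) :=
    hasSum_geometric_two.mul_left _
  refine (normU2_le_tsum (l := l) hA fun x hx => ?_).trans ?_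
  · have hsummable : Summable fun n => l n • A n x := .of_norm_bounded hgeom.summable fun n => by
      rw [norm_smul]
      exact (mul_le_of_le_one_right (norm_nonneg _) ((hA n).norm_le hx)).trans (hl n)
    rw [hsummable.hasSum_iff_tendsto_nat]
    simp only [hlA _ x hx, Finset.sum_range_sub (fun n => gridApprox a b w n x)]
    simpa only [gridApprox, Pi.zero_apply, sub_zero] using
      tendsto_gridApprox (hw.continuousOn.mono Ico_subset_Icc_self) hx
  · calc ∑' n, ‖l n‖ₑ ≤ ∑' n, ENNReal.ofReal (K * (4 * (b - a)) * (1 / 2) ^ n) :=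
          ENNReal.tsum_le_tsum fun n => by
            rw [← ofReal_norm]
            exact ENNReal.ofReal_le_ofReal (hl n)
      _ = ENNReal.ofReal (8 * K * (b - a)) := by
          rw [← ENNReal.ofReal_tsum_of_nonneg (fun n => by positivity) hgeom.summable,
            hgeom.tsum_eq]
          ring_nf
      _ = 8 * K * ENNReal.ofReal (b - a) := by
          rw [ENNReal.ofReal_mul (by positivity), ENNReal.ofReal_mul (by norm_num),
            ENNReal.ofReal_coe_nnreal, ENNReal.ofReal_ofNat]

end USquared

section DUSquared

variable {E : Type*} [NormedAddCommGroup E] [NormedSpace ℝ E] {F : ℝ → E}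

theorem integral_deriv_smul_neg_integral_Ioi {𝕜 : Type*} [RCLike 𝕜] [NormedSpace 𝕜 E]
    [CompleteSpace E] (hF : Integrable F) {ψ : ℝ → 𝕜} (hψ : ContDiff ℝ 1 ψ)
    (hc : HasCompactSupport ψ) :
    ∫ x, deriv ψ x • (-∫ y in Ioi x, F y) = -∫ x, ψ x • F x := by
  have hdψ : Integrable (deriv ψ) :=
    (hψ.continuous_deriv le_rfl).integrable_of_hasCompactSupport hc.deriv
  have hprod : Integrable (Function.uncurry fun x y : ℝ =>
      (Ioi x).indicator (fun y => deriv ψ x • F y) y) (volume.prod volume) :=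
    ((hdψ.smul_prod hF).indicator (measurableSet_lt measurable_fst measurable_snd)).congr
      (Eventually.of_forall fun z => by simp [Function.uncurry, indicator])
  simp_rw [smul_neg, integral_neg]
  congr 1
  calc ∫ x, deriv ψ x • ∫ y in Ioi x, F y
      = ∫ x, ∫ y, (Ioi x).indicator (fun y => deriv ψ x • F y) y := by
        simp_rw [integral_indicator measurableSet_Ioi, integral_smul]
    _ = ∫ y, ∫ x, (Ioi x).indicator (fun y => deriv ψ x • F y) y := integral_integral_swap hprod
    _ = ∫ y, ∫ x, (Iio y).indicator (fun x => deriv ψ x • F y) x := by simp [indicator]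
    _ = ∫ y, ψ y • F y := by
        simp_rw [integral_indicator measurableSet_Iio, integral_smul_const,
          ← integral_Iic_eq_integral_Iio, hc.integral_Iic_deriv_eq hψ]

theorem lipschitzWith_neg_integral_Ioi (hF : Integrable F) {M : ℝ≥0} (hM : ∀ᵐ x, ‖F x‖ ≤ M) :
    LipschitzWith M fun x => -∫ y in Ioi x, F y := by
  refine .of_dist_le_mul fun x y => ?_
  have hsub : (-∫ z in Ioi x, F z) - (-∫ z in Ioi y, F z) = ∫ z in y..x, F z := by
    rw [← intervalIntegral.integral_Ioi_sub_Ioi' hF.integrableOn hF.integrableOn]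
    abel
  rw [dist_eq_norm, hsub, Real.dist_eq]
  exact intervalIntegral.norm_integral_le_of_norm_le_const_ae (hM.mono fun z hz _ => hz)

theorem hasWeakTimeDeriv_neg_integral_Ioi {a b : ℝ} {f : ℝ → L2} (hf : IntegrableOn f (Ico a b)) :
    HasWeakTimeDeriv a b (fun x => -∫ y in Ioi x, (Ico a b).indicator f y) f := by
  have hF : Integrable ((Ico a b).indicator f) := hf.integrable_indicator measurableSet_Ico
  have hcont : Continuous fun x => -∫ y in Ioi x, (Ico a b).indicator f y := by
    have hprim := (intervalIntegral.continuous_primitive (fun _ _ => hF.intervalIntegrable) a).sub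
      (continuous_const (y := ∫ y in Ioi a, (Ico a b).indicator f y))
    refine hprim.congr fun x => ?_
    rw [Pi.sub_apply, ← intervalIntegral.integral_Ioi_sub_Ioi' hF.integrableOn hF.integrableOn]
    abel
  refine ⟨hcont.locallyIntegrable.locallyIntegrableOn _,
    (hf.mono_set Ioo_subset_Ico_self).locallyIntegrableOn, fun ψ hψ hc hsupp => ?_⟩
  rw [integral_deriv_smul_neg_integral_Ioi hF (hψ.of_le (mod_cast le_top)) hc]
  congr 2 with x
  by_cases hx : x ∈ Ico a b
  · rw [indicator_of_mem hx]
  · rw [image_eq_zero_of_notMem_tsupport fun h => hx (Ioo_subset_Ico_self (hsupp h)), zero_smul,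
      zero_smul]

theorem normDU2_le_eLpNorm_top {a b : ℝ} (hab : a < b) {f : ℝ → L2}
    (hf : AEStronglyMeasurable f (volume.restrict (Ico a b))) :
    normDU2 a b f ≤
      8 * eLpNorm f ∞ (volume.restrict (Ico a b)) * ENNReal.ofReal (b - a) := by
  rcases eq_or_ne (eLpNorm f ∞ (volume.restrict (Ico a b))) ∞ with htop | hfin
  · simp [htop, ENNReal.mul_top, ENNReal.top_mul, hab]
  have hint : IntegrableOn f (Ico a b) :=
    memLp_one_iff_integrable.1 (MemLp.mono_exponent ⟨hf, hfin.lt_top⟩ le_top)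
  lift eLpNorm f ∞ (volume.restrict (Ico a b)) to ℝ≥0 using hfin with M hM
  have hfM : ∀ᵐ x, ‖(Ico a b).indicator f x‖ ≤ M := by
    rw [← eLpNorm_indicator_eq_eLpNorm_restrict measurableSet_Ico, eLpNorm_exponent_top] at hM
    filter_upwards [enorm_ae_le_eLpNormEssSup ((Ico a b).indicator f) volume] with x hx
    rwa [← hM, ← ofReal_norm, ← ENNReal.ofReal_coe_nnreal,
      ENNReal.ofReal_le_ofReal_iff M.coe_nonneg] at hx
  set w : ℝ → L2 := fun x => -∫ y in Ioi x, (Ico a b).indicator f y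
  have hlip : LipschitzWith M w :=
    lipschitzWith_neg_integral_Ioi (hint.integrable_indicator measurableSet_Ico) hfM
  have hwb : w b = 0 := by
    refine neg_eq_zero.2 (setIntegral_eq_zero_of_forall_eq_zero fun x hx => ?_)
    exact indicator_of_notMem (fun h => h.2.not_gt hx) _
  have hlim : Tendsto w (𝓝[<] b) (𝓝 0) :=
    hwb ▸ (hlip.continuous.tendsto b).mono_left nhdsWithin_le_nhds
  exact (iInf₂_le_of_le w hlim (iInf_le _ (hasWeakTimeDeriv_neg_integral_Ioi hint))).trans
    (normU2_le_of_lipschitzOnWith hab hwb hlip.lipschitzOnWith)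

end DUSquared

section Sequences

theorem sq_tsum_mul_le {ι : Type*} (f g : ι → ℝ≥0∞) :
    (∑' i, f i * g i) ^ 2 ≤ (∑' i, f i ^ 2) * ∑' i, g i ^ 2 := by
  have holder : ∑' i, f i * g i ≤
      (∑' i, f i ^ 2) ^ (1 / 2 : ℝ) * (∑' i, g i ^ 2) ^ (1 / 2 : ℝ) := by
    rw [ENNReal.tsum_eq_iSup_sum]
    refine iSup_le fun s => (ENNReal.inner_le_Lp_mul_Lq s f g .two_two).trans ?_
    simp only [ENNReal.rpow_two]
    gcongr <;> exact ENNReal.sum_le_tsum s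
  calc (∑' i, f i * g i) ^ 2
      ≤ ((∑' i, f i ^ 2) ^ (1 / 2 : ℝ) * (∑' i, g i ^ 2) ^ (1 / 2 : ℝ)) ^ 2 := by gcongr
    _ = (∑' i, f i ^ 2) * ∑' i, g i ^ 2 := by
      rw [mul_pow, ← ENNReal.rpow_two, ← ENNReal.rpow_two, ← ENNReal.rpow_mul, ← ENNReal.rpow_mul]
      norm_num

theorem ennreal_add_sq_le (x y : ℝ≥0∞) : (x + y) ^ 2 ≤ 2 * (x ^ 2 + y ^ 2) := by
  simpa [show (2 : ℝ) - 1 = 1 by norm_num] using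
    ENNReal.rpow_add_le_mul_rpow_add_rpow x y one_le_two

/-- In a convolution `∑ m, a (k - m) * b m`, the terms with `b` restricted to `H` and those with
`a` restricted to `L` are estimated separately. -/
theorem sq_tsum_sub_mul_le {G : Type*} [AddCommGroup G] (a b : G → ℝ≥0∞) {k : G} {L H : Set G}
    (hLH : ∀ m, m ∈ H ∨ k - m ∈ L) :
    (∑' m, a (k - m) * b m) ^ 2 ≤
      2 * ((∑' m, a m ^ 2) * ∑' m : H, b m ^ 2 + (∑' m : L, a m ^ 2) * ∑' m, b m ^ 2) := by
  have reindex (F : G → ℝ≥0∞) : ∑' m, F (k - m) = ∑' m, F m := (Equiv.subLeft k).tsum_eq F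
  set L' : Set G := (k - ·) ⁻¹' L
  have hL' : ∑' m : L', a (k - m) ^ 2 = ∑' m : L, a m ^ 2 := by
    rw [tsum_subtype L' fun m => a (k - m) ^ 2, tsum_subtype L fun m => a m ^ 2,
      ← reindex (L.indicator _)]
    rfl
  calc (∑' m, a (k - m) * b m) ^ 2
      = (∑' m : ↑(H ∪ L'), a (k - m) * b m) ^ 2 := by
        rw [show H ∪ L' = univ from eq_univ_of_forall hLH,
          tsum_univ fun m => a (k - m) * b m]
    _ ≤ (∑' m : H, a (k - m) * b m + ∑' m : L', a (k - m) * b m) ^ 2 := by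
        gcongr
        exact ENNReal.tsum_union_le (fun m => a (k - m) * b m) H L'
    _ ≤ 2 * ((∑' m : H, a (k - m) * b m) ^ 2 + (∑' m : L', a (k - m) * b m) ^ 2) :=
        ennreal_add_sq_le _ _
    _ ≤ 2 * ((∑' m : H, a (k - m) ^ 2) * ∑' m : H, b m ^ 2 +
          (∑' m : L', a (k - m) ^ 2) * ∑' m : L', b m ^ 2) := by
        gcongr <;> exact sq_tsum_mul_le _ _
    _ ≤ 2 * ((∑' m, a m ^ 2) * ∑' m : H, b m ^ 2 + (∑' m : L, a m ^ 2) * ∑' m, b m ^ 2) := by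
        gcongr
        · rw [← reindex fun m => a m ^ 2]
          exact ENNReal.tsum_comp_le_tsum_of_injective Subtype.val_injective _
        · exact hL'.le
        · exact ENNReal.tsum_comp_le_tsum_of_injective Subtype.val_injective _

theorem tsum_mul_tsum_subtype_le {ι κ : Type*} {r : ι → κ → Prop} {w : ι → ℝ≥0∞}
    {w' : κ → ℝ≥0∞} {C : ℝ≥0∞} (h : ∀ l, ∑' i : {i | r i l}, w i ≤ C * w' l) (β : κ → ℝ≥0∞) :
    ∑' i, w i * ∑' l : {l | r i l}, β l ≤ C * ∑' l, w' l * β l := by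
  classical
  calc ∑' i, w i * ∑' l : {l | r i l}, β l
      = ∑' i, ∑' l, {i | r i l}.indicator w i * β l := by
        refine tsum_congr fun i => ?_
        rw [tsum_subtype, ← ENNReal.tsum_mul_left]
        refine tsum_congr fun l => ?_
        by_cases hil : r i l <;> simp [indicator, hil]
    _ = ∑' l, (∑' i : {i | r i l}, w i) * β l := by
        rw [ENNReal.tsum_comm]
        simp_rw [ENNReal.tsum_mul_right, tsum_subtype]
    _ ≤ ∑' l, C * (w' l * β l) := ENNReal.tsum_le_tsum fun l => by
        rw [← mul_assoc]
        gcongr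
        exact h l
    _ = C * ∑' l, w' l * β l := ENNReal.tsum_mul_left

theorem tsum_pow_le_succ_le {q : ℝ≥0∞} (hq0 : q ≠ 0) (hq : q ≠ ⊤) (l : ℕ) :
    ∑' J : {J | J ≤ l + 1}, q ^ (J : ℕ) ≤ q * (1 - q⁻¹)⁻¹ * q ^ l := by
  have hrange : {J | J ≤ l + 1} = ↑(Finset.range (l + 2)) := by
    ext J
    simp [Nat.lt_succ_iff]
  rw [hrange, Finset.tsum_subtype' (Finset.range (l + 2)) (q ^ ·), ← Finset.sum_range_reflect]
  calc ∑ i ∈ Finset.range (l + 2), q ^ (l + 2 - 1 - i)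
      = ∑ i ∈ Finset.range (l + 2), q ^ (l + 1) * q⁻¹ ^ i := by
        refine Finset.sum_congr rfl fun i hi => ?_
        rw [← ENNReal.inv_pow, ← div_eq_mul_inv]
        exact (ENNReal.eq_div_iff (pow_ne_zero _ hq0) (ENNReal.pow_ne_top hq)).2
          (by rw [← pow_add]; congr 1; grind)
    _ ≤ q ^ (l + 1) * ∑' i, q⁻¹ ^ i := by
        rw [← Finset.mul_sum]
        gcongr
        exact ENNReal.sum_le_tsum _
    _ = q * (1 - q⁻¹)⁻¹ * q ^ l := by
        rw [ENNReal.tsum_geometric, pow_succ]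
        ring

theorem tsum_pow_near_le {p : ℝ≥0∞} (hp : 1 ≤ p) (j : ℕ) :
    ∑' J : {J | j ≤ J + 1 ∧ J ≤ j + 1}, p ^ (J : ℕ) ≤ 3 * p * p ^ j := by
  have hIcc : {J | j ≤ J + 1 ∧ J ≤ j + 1} = ↑(Finset.Icc (j - 1) (j + 1)) := by
    ext J
    simp
  rw [hIcc, Finset.tsum_subtype' (Finset.Icc (j - 1) (j + 1)) (p ^ ·)]
  calc ∑ J ∈ Finset.Icc (j - 1) (j + 1), p ^ J
      ≤ (Finset.Icc (j - 1) (j + 1)).card • p ^ (j + 1) :=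
        Finset.sum_le_card_nsmul _ _ _ fun J hJ => pow_le_pow_right₀ hp (Finset.mem_Icc.1 hJ).2
    _ ≤ 3 • p ^ (j + 1) := by
        gcongr
        rw [Nat.card_Icc]
        omega
    _ = 3 * p * p ^ j := by
        rw [nsmul_eq_mul, pow_succ']
        push_cast
        ring

/-- The bound for the square of a Fourier coefficient of `u v` at a frequency of level `J`, where
`α` and `β` are the energies of `u` and `v` on the annuli: either `v` contributes a frequency of
level `≥ J - 1`, or `u` contributes one of level `J - 1`, `J` or `J + 1`. -/
noncomputable def convBound (α β : ℕ → ℝ≥0∞) (J : ℕ) : ℝ≥0∞ :=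
  2 * ((∑' j, α j) * ∑' l : {l | J ≤ l + 1}, β l +
    (∑' j : {j | j ≤ J + 1 ∧ J ≤ j + 1}, α j) * ∑' l, β l)

theorem convBound_mono {α α' β β' : ℕ → ℝ≥0∞} (hα : ∀ j, α j ≤ α' j) (hβ : ∀ l, β l ≤ β' l)
    (J : ℕ) : convBound α β J ≤ convBound α' β' J := by
  unfold convBound
  gcongr <;> apply_rules

theorem tsum_pow_mul_convBound_le {p q : ℝ≥0∞} (hp : 1 ≤ p) (hpq : p ≤ q) (hq : q ≠ ⊤)
    (α β : ℕ → ℝ≥0∞) :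
    ∑' J, p ^ J * convBound α β J ≤
      2 * (q * (1 - q⁻¹)⁻¹ + 3 * q) * ((∑' j, p ^ j * α j) * ∑' l, q ^ l * β l) := by
  have hq1 : 1 ≤ q := hp.trans hpq
  have le_weighted {r : ℝ≥0∞} (hr : 1 ≤ r) (γ : ℕ → ℝ≥0∞) : ∑' j, γ j ≤ ∑' j, r ^ j * γ j :=
    ENNReal.tsum_le_tsum fun j => le_mul_of_one_le_left' (one_le_pow₀ hr)
  have high : ∑' J, p ^ J * ∑' l : {l | J ≤ l + 1}, β l ≤
      q * (1 - q⁻¹)⁻¹ * ∑' l, q ^ l * β l :=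
    (ENNReal.tsum_le_tsum fun J => by gcongr).trans (tsum_mul_tsum_subtype_le (w := (q ^ ·))
      (tsum_pow_le_succ_le (zero_lt_one.trans_le hq1).ne' hq) β)
  have near : ∑' J, p ^ J * ∑' j : {j | j ≤ J + 1 ∧ J ≤ j + 1}, α j ≤
      3 * p * ∑' j, p ^ j * α j :=
    tsum_mul_tsum_subtype_le (r := fun J j => j ≤ J + 1 ∧ J ≤ j + 1) (tsum_pow_near_le hp) α
  calc ∑' J, p ^ J * convBound α β J
      = 2 * ((∑' j, α j) * ∑' J, p ^ J * ∑' l : {l | J ≤ l + 1}, β l +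
          (∑' J, p ^ J * ∑' j : {j | j ≤ J + 1 ∧ J ≤ j + 1}, α j) * ∑' l, β l) := by
        rw [← ENNReal.tsum_mul_left, ← ENNReal.tsum_mul_right, ← ENNReal.tsum_add,
          ← ENNReal.tsum_mul_left]
        refine tsum_congr fun J => ?_
        rw [convBound]
        ring
    _ ≤ 2 * ((∑' j, p ^ j * α j) * (q * (1 - q⁻¹)⁻¹ * ∑' l, q ^ l * β l) +
          3 * q * (∑' j, p ^ j * α j) * ∑' l, q ^ l * β l) := by
        gcongr 2 * (?_ * ?_ + ?_ * ?_)
        · exact le_weighted hp α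
        · exact near.trans (by gcongr)
        · exact le_weighted hq1 β
    _ = 2 * (q * (1 - q⁻¹)⁻¹ + 3 * q) * ((∑' j, p ^ j * α j) * ∑' l, q ^ l * β l) := by ring

end Sequences

open UnitAddTorus

section Fourier

section Product

variable {d : Type*} [Fintype d]
  (g h : Lp ℂ 2 (Measure.pi fun _ : d => (AddCircle.haarAddCircle : Measure UnitAddCircle)))
  (k : d → ℤ)

theorem exists_ae_eq_mFourier_mul_conj :
    ∃ G : Lp ℂ 2 (Measure.pi fun _ : d => (AddCircle.haarAddCircle : Measure UnitAddCircle)),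
      ⇑G =ᵐ[Measure.pi fun _ => AddCircle.haarAddCircle]
        fun x => mFourier k x * starRingEnd ℂ (g x) := by
  have hG : MemLp (fun x => mFourier k x * starRingEnd ℂ (g x)) 2
      (Measure.pi fun _ : d => (AddCircle.haarAddCircle : Measure UnitAddCircle)) := by
    refine (Lp.memLp g).of_le ((mFourier k).continuous.aestronglyMeasurable.mul
      (Complex.continuous_conj.comp_aestronglyMeasurable (Lp.aestronglyMeasurable g)))
      (Eventually.of_forall fun x => ?_)
    rw [norm_mul, RCLike.norm_conj]
    exact mul_le_of_le_one_left (norm_nonneg _)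
      (((mFourier k).norm_coe_le_norm x).trans mFourier_norm.le)
  exact ⟨hG.toLp _, hG.coeFn_toLp⟩

/-- This is Parseval's identity for the scalar product of `e_k * conj g` and `h`. -/
theorem hasSum_mFourierCoeff_mul :
    HasSum (fun m => mFourierCoeff g (k - m) * mFourierCoeff h m)
      (mFourierCoeff (fun x => g x * h x) k) := by
  obtain ⟨G, hG⟩ := exists_ae_eq_mFourier_mul_conj g k
  have coeff_G (m : d → ℤ) : starRingEnd ℂ (mFourierCoeff G m) = mFourierCoeff g (k - m) := by
    rw [mFourierCoeff, mFourierCoeff, ← integral_conj]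
    refine integral_congr_ae ?_
    filter_upwards [hG] with x hx
    rw [hx, neg_sub, sub_eq_add_neg, mFourier_add]
    simp only [smul_eq_mul, map_mul, Complex.conj_conj, mFourier_neg]
    ring
  have inner_G : ∫ x, starRingEnd ℂ (G x) * h x ∂(Measure.pi fun _ => AddCircle.haarAddCircle) =
      mFourierCoeff (fun x => g x * h x) k := by
    rw [mFourierCoeff]
    refine integral_congr_ae ?_
    filter_upwards [hG] with x hx
    rw [hx]
    simp only [smul_eq_mul, map_mul, Complex.conj_conj, mFourier_neg]
    ring
  simp_rw [← coeff_G, ← inner_G]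
  exact hasSum_prod_mFourierCoeff G h

end Product

theorem repr_propagator (t : ℝ) (f : L2) (k : Fin 2 → ℤ) :
    mFourierBasis.repr (propagator t f) k =
      Complex.exp (Complex.I * ((t * phase k : ℝ) : ℂ)) * mFourierBasis.repr f k := by
  rw [propagator, LinearIsometryEquiv.apply_symm_apply]

theorem norm_propagator (t : ℝ) (f : L2) : ‖propagator t f‖ = ‖f‖ := by
  rw [← mFourierBasis.repr.norm_map (propagator t f), ← mFourierBasis.repr.norm_map f,
    lp.norm_eq_tsum_rpow (by simp), lp.norm_eq_tsum_rpow (by simp)]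
  simp_rw [repr_propagator, norm_mul, mul_comm Complex.I, Complex.norm_exp_ofReal_mul_I, one_mul]

theorem repr_lpProj (j : ℕ) (c : Coeffs) (k : Fin 2 → ℤ) :
    mFourierBasis.repr (lpProj j c) k = (annulus j).indicator c k := by
  classical
  rw [HilbertBasis.repr_apply_apply, lpProj, inner_sum, coe_mFourierBasis]
  simp_rw [inner_smul_right, orthonormal_iff_ite.1 orthonormal_mFourier]
  simp [indicator]

theorem propagator_lpProj (t : ℝ) (j : ℕ) (c : Coeffs) :
    propagator t (lpProj j c) =
      lpProj j (fun k => Complex.exp (Complex.I * ((t * phase k : ℝ) : ℂ)) * c k) := by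
  apply mFourierBasis.repr.injective
  ext k
  rw [repr_propagator, repr_lpProj, repr_lpProj]
  by_cases hk : k ∈ annulus j <;> simp [hk]

theorem enorm_lpProj_sq (j : ℕ) (c : Coeffs) :
    ‖lpProj j c‖ₑ ^ 2 = ∑ k ∈ (annulus_finite j).toFinset, ‖c k‖ₑ ^ 2 := by
  have hnorm : ‖lpProj j c‖ ^ 2 = ∑ k ∈ (annulus_finite j).toFinset, ‖c k‖ ^ 2 := by
    have h := inner_self_eq_norm_sq_to_K (𝕜 := ℂ) (lpProj j c)
    rw [lpProj, orthonormal_mFourier.inner_sum] at h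
    simp_rw [RCLike.conj_mul] at h
    exact_mod_cast h.symm
  simp_rw [← ofReal_norm, ← ENNReal.ofReal_pow (norm_nonneg _)]
  rw [hnorm, ENNReal.ofReal_sum_of_nonneg fun _ _ => by positivity]

theorem abs_coord_le_freqNorm (k : Fin 2 → ℤ) (i : Fin 2) : |(k i : ℝ)| ≤ freqNorm k := by
  refine Real.abs_le_sqrt ?_
  fin_cases i
  · simpa using sq_nonneg (k 1 : ℝ)
  · simpa using sq_nonneg (k 0 : ℝ)

theorem freqNorm_add_le (m n : Fin 2 → ℤ) : freqNorm (m + n) ≤ freqNorm m + freqNorm n := by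
  have freqNorm_eq (k : Fin 2 → ℤ) :
      freqNorm k = ‖((k 0 : ℝ) : ℂ) + ((k 1 : ℝ) : ℂ) * Complex.I‖ :=
    (Complex.norm_add_mul_I _ _).symm
  simp only [freqNorm_eq]
  refine (congrArg norm ?_).trans_le (norm_add_le _ _)
  simp only [Pi.add_apply]
  push_cast
  ring

theorem freqNorm_neg (m : Fin 2 → ℤ) : freqNorm (-m) = freqNorm m := by
  simp [freqNorm]

theorem exists_mem_annulus (k : Fin 2 → ℤ) : ∃ j, k ∈ annulus j := by
  rcases lt_or_ge (freqNorm k) 2 with h | h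
  · exact ⟨0, by simpa using h, Or.inl rfl⟩
  · obtain ⟨n, hn, hn'⟩ := exists_nat_pow_near (one_le_two.trans h) one_lt_two
    exact ⟨n, hn', Or.inr hn⟩

theorem level_sub_of_low {k m : Fin 2 → ℤ} {J j l : ℕ} (hk : k ∈ annulus J) (hm : m ∈ annulus l)
    (hl : l + 2 ≤ J) (hj : k - m ∈ annulus j) : j ≤ J + 1 ∧ J ≤ j + 1 := by
  obtain ⟨I, rfl⟩ : ∃ I, J = I + 2 := ⟨J - 2, by omega⟩
  have hp : (0 : ℝ) < 2 ^ I := by positivity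
  have hm_lt : freqNorm m < 2 ^ (I + 1) := hm.1.trans_le (pow_le_pow_right₀ one_le_two (by omega))
  have hk_ge : (2 : ℝ) ^ (I + 2) ≤ freqNorm k := hk.2.resolve_left (by omega)
  have hk_lt := hk.1
  have hk_le := freqNorm_add_le (k - m) m
  have hkm_le := freqNorm_add_le k (-m)
  rw [sub_add_cancel] at hk_le
  rw [freqNorm_neg, ← sub_eq_add_neg] at hkm_le
  simp only [pow_succ] at hk_ge hk_lt hm_lt
  constructor <;> by_contra! hjJ
  · have hj_ge : (2 : ℝ) ^ j ≤ freqNorm (k - m) := hj.2.resolve_left (by omega)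
    have hpow : (2 : ℝ) ^ (I + 4) ≤ 2 ^ j := pow_le_pow_right₀ one_le_two (by omega)
    simp only [pow_succ] at hpow
    linarith
  · have hj_lt := hj.1
    have hpow : (2 : ℝ) ^ (j + 1) ≤ 2 ^ (I + 1) := pow_le_pow_right₀ one_le_two (by omega)
    simp only [pow_succ] at hpow hj_lt
    linarith

theorem tsum_biUnion_annulus_le (c : Coeffs) (P : Set ℕ) :
    ∑' k : ⋃ j ∈ P, annulus j, ‖c k‖ₑ ^ 2 ≤ ∑' j : P, ‖lpProj j c‖ₑ ^ 2 := by
  refine (ENNReal.tsum_biUnion_le_tsum (fun k => ‖c k‖ₑ ^ 2) P annulus).trans_eq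
    (tsum_congr fun j => ?_)
  rw [enorm_lpProj_sq, ← Finset.tsum_subtype' _ fun k => ‖c k‖ₑ ^ 2, Set.Finite.coe_toFinset]

theorem tsum_enorm_sq_le_tsum_lpProj (c : Coeffs) : ∑' k, ‖c k‖ₑ ^ 2 ≤ ∑' j, ‖lpProj j c‖ₑ ^ 2 := by
  have hcover : ⋃ j ∈ (univ : Set ℕ), annulus j = univ :=
    eq_univ_of_forall fun k => by simpa using exists_mem_annulus k
  have h := tsum_biUnion_annulus_le c univ
  rwa [hcover, tsum_univ fun k => ‖c k‖ₑ ^ 2, tsum_univ fun j => ‖lpProj j c‖ₑ ^ 2] at h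

theorem enorm_sq_le_convBound_of_hasSum {a b : Coeffs} {c : ℂ} {k : Fin 2 → ℤ} {J : ℕ}
    (hk : k ∈ annulus J) (hc : HasSum (fun m => a (k - m) * b m) c) :
    ‖c‖ₑ ^ 2 ≤ convBound (fun j => ‖lpProj j a‖ₑ ^ 2) (fun l => ‖lpProj l b‖ₑ ^ 2) J := by
  have hlevels (m : Fin 2 → ℤ) : m ∈ ⋃ l ∈ {l | J ≤ l + 1}, annulus l ∨
      k - m ∈ ⋃ j ∈ {j | j ≤ J + 1 ∧ J ≤ j + 1}, annulus j := by
    obtain ⟨l, hl⟩ := exists_mem_annulus m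
    obtain ⟨j, hj⟩ := exists_mem_annulus (k - m)
    by_cases hJl : J ≤ l + 1
    · exact Or.inl (mem_biUnion hJl hl)
    · exact Or.inr (mem_biUnion (level_sub_of_low hk hl (by omega) hj) hj)
  calc ‖c‖ₑ ^ 2 ≤ (∑' m, ‖a (k - m)‖ₑ * ‖b m‖ₑ) ^ 2 := by
        rw [← hc.tsum_eq]
        gcongr
        exact enorm_tsum_le_tsum_enorm.trans_eq (tsum_congr fun m => enorm_mul _ _)
    _ ≤ _ := sq_tsum_sub_mul_le (fun m => ‖a m‖ₑ) (fun m => ‖b m‖ₑ) hlevels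
    _ ≤ convBound (fun j => ‖lpProj j a‖ₑ ^ 2) (fun l => ‖lpProj l b‖ₑ ^ 2) J := by
        rw [convBound]
        gcongr 2 * (?_ * ?_ + ?_ * ?_)
        · exact tsum_enorm_sq_le_tsum_lpProj a
        · exact tsum_biUnion_annulus_le b _
        · exact tsum_biUnion_annulus_le a _
        · exact tsum_enorm_sq_le_tsum_lpProj b

theorem card_annulus_le (j : ℕ) : (annulus_finite j).toFinset.card ≤ 25 * 4 ^ j := by
  have hbox : (annulus_finite j).toFinset ⊆
      Finset.Icc (fun _ : Fin 2 => -(2 : ℤ) ^ (j + 1)) (fun _ => (2 : ℤ) ^ (j + 1)) := by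
    intro k hk
    have hk := ((annulus_finite j).mem_toFinset.1 hk).1
    have hcoord (i : Fin 2) := abs_le.1 ((abs_coord_le_freqNorm k i).trans hk.le)
    exact Finset.mem_Icc.2
      ⟨fun i => by exact_mod_cast (hcoord i).1, fun i => by exact_mod_cast (hcoord i).2⟩
  have hside : ((2 : ℤ) ^ (j + 1) + 1 - -2 ^ (j + 1)).toNat ≤ 5 * 2 ^ j := by
    have : (1 : ℤ) ≤ 2 ^ j := one_le_pow₀ one_le_two
    rw [Int.toNat_le, pow_succ]
    push_cast
    linarith
  calc (annulus_finite j).toFinset.card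
      ≤ ((2 : ℤ) ^ (j + 1) + 1 - -2 ^ (j + 1)).toNat ^ 2 := by
        simpa [Pi.card_Icc] using Finset.card_le_card hbox
    _ ≤ (5 * 2 ^ j) ^ 2 := Nat.pow_le_pow_left hside 2
    _ = 25 * 4 ^ j := by
        rw [mul_pow, ← pow_mul, mul_comm j 2, pow_mul]
        norm_num

theorem enorm_lpProj_sq_le {j : ℕ} {c : Coeffs} {Q : ℝ≥0∞}
    (hQ : ∀ k ∈ annulus j, ‖c k‖ₑ ^ 2 ≤ Q) : ‖lpProj j c‖ₑ ^ 2 ≤ 25 * 4 ^ j * Q :=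
  calc ‖lpProj j c‖ₑ ^ 2 = ∑ k ∈ (annulus_finite j).toFinset, ‖c k‖ₑ ^ 2 := enorm_lpProj_sq j c
    _ ≤ (annulus_finite j).toFinset.card • Q :=
        Finset.sum_le_card_nsmul _ _ _ fun k hk => hQ k ((annulus_finite j).mem_toFinset.1 hk)
    _ ≤ (25 * 4 ^ j) • Q := by gcongr; exact card_annulus_le j
    _ = 25 * 4 ^ j * Q := by rw [nsmul_eq_mul]; push_cast; rfl

theorem enorm_dxMul_sq_le {k : Fin 2 → ℤ} {J : ℕ} (hk : k ∈ annulus J) (g h : L2) :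
    ‖dxMul g h k‖ₑ ^ 2 ≤ 4 * 4 ^ J * ‖mFourierCoeff (fun x => g x * h x) k‖ₑ ^ 2 := by
  have hsymbol : ‖Complex.I * (k 0 : ℂ)‖ₑ ≤ 2 ^ (J + 1) := by
    rw [← ofReal_norm, norm_mul, Complex.norm_I, one_mul, Complex.norm_intCast]
    exact (ENNReal.ofReal_le_ofReal ((abs_coord_le_freqNorm k 0).trans hk.1.le)).trans_eq
      (by rw [ENNReal.ofReal_pow zero_le_two, ENNReal.ofReal_ofNat])
  rw [dxMul, enorm_mul, mul_pow]
  gcongr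
  calc ‖Complex.I * (k 0 : ℂ)‖ₑ ^ 2 ≤ (2 ^ (J + 1)) ^ 2 := by gcongr
    _ = 4 * 4 ^ J := by
      rw [← pow_mul, mul_comm, pow_mul, pow_succ']
      norm_num

theorem enorm_lpProj_dxMul_sq_le (g h : L2) (J : ℕ) :
    ‖lpProj J (dxMul g h)‖ₑ ^ 2 ≤ 100 * 16 ^ J *
      convBound (fun j => ‖lpProj j (mFourierCoeff g)‖ₑ ^ 2)
        (fun l => ‖lpProj l (mFourierCoeff h)‖ₑ ^ 2) J := by
  refine (enorm_lpProj_sq_le fun k hk => (enorm_dxMul_sq_le hk g h).trans (mul_le_mul_right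
    (enorm_sq_le_convBound_of_hasSum hk (hasSum_mFourierCoeff_mul g h k)) _)).trans_eq ?_
  rw [show (16 : ℝ≥0∞) = 4 * 4 by norm_num, mul_pow]
  ring

end Fourier

section Windows

theorem window_pos {T : ℝ} (hT : 0 < T) (j : ℕ) : 0 < window T j :=
  lt_min (by positivity) hT

theorem window_le (T : ℝ) (j : ℕ) : window T j ≤ T := min_le_right _ _

theorem ofReal_window_sq_mul_le (T : ℝ) (j : ℕ) :
    ENNReal.ofReal (window T j) ^ 2 * 16 ^ j ≤ 1 := by
  have hwindow : ENNReal.ofReal (window T j) ≤ (4 ^ j)⁻¹ := by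
    refine (ENNReal.ofReal_le_ofReal (min_le_left _ _)).trans_eq ?_
    rw [show ((2 : ℝ) ^ j) ^ (-2 : ℤ) = (4 ^ j)⁻¹ by
        rw [zpow_neg, ← Nat.cast_two (R := ℤ), zpow_natCast, ← pow_mul, mul_comm, pow_mul]
        norm_num,
      ENNReal.ofReal_inv_of_pos (by positivity), ENNReal.ofReal_pow (by norm_num),
      ENNReal.ofReal_ofNat]
  calc ENNReal.ofReal (window T j) ^ 2 * 16 ^ j ≤ ((4 ^ j)⁻¹) ^ 2 * (4 ^ j) ^ 2 := by
        rw [← pow_mul 4, mul_comm j 2, pow_mul 4]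
        gcongr
        norm_num
    _ = 1 := by
        rw [← mul_pow, ENNReal.inv_mul_cancel (by positivity) (by finiteness), one_pow]

/-- The left endpoints of a sequence of windows that covers `[0,T)`; the last ones are moved to the
left so as not to leave `[0,T)`. -/
noncomputable def windowStart (T : ℝ) (j n : ℕ) : ℝ := min (n * window T j) (T - window T j)

theorem windowStart_nonneg {T : ℝ} (hT : 0 < T) (j n : ℕ) : 0 ≤ windowStart T j n :=
  le_min (mul_nonneg n.cast_nonneg (window_pos hT j).le) (sub_nonneg.2 (window_le T j))

theorem windowStart_add_window_le (T : ℝ) (j n : ℕ) : windowStart T j n + window T j ≤ T :=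
  le_sub_iff_add_le.1 (min_le_right _ _)

theorem exists_mem_Ico_windowStart {T t : ℝ} (ht : t ∈ Ico 0 T) (j : ℕ) :
    ∃ n, t ∈ Ico (windowStart T j n) (windowStart T j n + window T j) := by
  have hw : 0 < window T j := window_pos (ht.1.trans_lt ht.2) j
  have hle : (⌊t / window T j⌋₊ : ℝ) * window T j ≤ t :=
    (le_div_iff₀ hw).1 (Nat.floor_le (div_nonneg ht.1 hw.le))
  have hlt : t < (⌊t / window T j⌋₊ + 1 : ℝ) * window T j :=
    (div_lt_iff₀ hw).1 (Nat.lt_floor_add_one _)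
  refine ⟨⌊t / window T j⌋₊, (min_le_left _ _).trans hle, ?_⟩
  rw [windowStart, ← min_add_add_right]
  exact lt_min (by linarith) (by linarith [ht.2])

/-- The contribution `sup_I ‖P_N f‖²_{X(I)}`, `N = 2 ^ j`, of a Littlewood–Paley block to the
square of a short-time norm. -/
noncomputable def blockEnergy (X : ℝ → ℝ → (ℝ → L2) → ℝ≥0∞) (T : ℝ) (f : ℝ → Coeffs) (j : ℕ) :
    ℝ≥0∞ :=
  (⨆ (a : ℝ) (_ : 0 ≤ a) (_ : a + window T j ≤ T),
    X a (a + window T j) (fun t => lpProj j (f t))) ^ 2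

variable {X : ℝ → ℝ → (ℝ → L2) → ℝ≥0∞} {T s : ℝ} {f : ℝ → Coeffs}

theorem sq_le_blockEnergy {a : ℝ} {j : ℕ} (ha : 0 ≤ a) (haT : a + window T j ≤ T) :
    X a (a + window T j) (fun t => lpProj j (f t)) ^ 2 ≤ blockEnergy X T f j := by
  refine pow_le_pow_left' (le_iSup₂_of_le a ha ?_) 2
  exact le_iSup_of_le haT le_rfl

theorem blockEnergy_le {j : ℕ} {Q : ℝ≥0∞} (h : ∀ a, 0 ≤ a → a + window T j ≤ T →
    X a (a + window T j) (fun t => lpProj j (f t)) ^ 2 ≤ Q) : blockEnergy X T f j ≤ Q := by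
  rw [blockEnergy, ← ENNReal.rpow_two, ← ENNReal.le_rpow_inv_iff two_pos]
  refine iSup₂_le fun a ha => iSup_le fun haT => ?_
  rw [ENNReal.le_rpow_inv_iff two_pos, ENNReal.rpow_two]
  exact h a ha haT

theorem shortTimeNorm_eq (X : ℝ → ℝ → (ℝ → L2) → ℝ≥0∞) (T s : ℝ) (f : ℝ → Coeffs) :
    shortTimeNorm X T s f =
      (∑' j, ENNReal.ofReal (2 ^ (2 * s)) ^ j * blockEnergy X T f j) ^ (1 / 2 : ℝ) := by
  have weight_eq (j : ℕ) : ENNReal.ofReal (((2 : ℝ) ^ j) ^ (2 * s)) =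
      ENNReal.ofReal (2 ^ (2 * s)) ^ j := by
    rw [← ENNReal.ofReal_pow (by positivity), ← Real.rpow_natCast, ← Real.rpow_natCast,
      ← Real.rpow_mul zero_le_two, ← Real.rpow_mul zero_le_two, mul_comm]
  simp_rw [← weight_eq]
  rfl

theorem blockEnergy_ne_top (h : shortTimeNorm X T s f ≠ ⊤) (j : ℕ) : blockEnergy X T f j ≠ ⊤ := by
  intro hj
  refine h ?_
  rw [shortTimeNorm_eq, ENNReal.tsum_eq_top_of_eq_top ⟨j, ?_⟩, ENNReal.top_rpow_of_pos (by simp)]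
  rw [hj, ENNReal.mul_top]
  exact pow_ne_zero _ (ENNReal.ofReal_pos.2 (by positivity)).ne'

theorem blockEnergy_eq_zero (h : shortTimeNorm X T s f = 0) (j : ℕ) : blockEnergy X T f j = 0 := by
  rw [shortTimeNorm_eq, ENNReal.rpow_eq_zero_iff_of_pos (by simp), ENNReal.tsum_eq_zero] at h
  exact (mul_eq_zero.1 (h j)).resolve_left
    (pow_ne_zero _ (ENNReal.ofReal_pos.2 (by positivity)).ne')

theorem enorm_lpProj_sq_le_blockEnergy {t : ℝ} (ht : t ∈ Ico 0 T) (f : ℝ → Coeffs) (j : ℕ) :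
    ‖lpProj j (f t)‖ₑ ^ 2 ≤ blockEnergy normU2ZK T f j := by
  obtain ⟨n, hn⟩ := exists_mem_Ico_windowStart ht j
  refine le_trans ?_ (sq_le_blockEnergy (windowStart_nonneg (ht.1.trans_lt ht.2) j n)
    (windowStart_add_window_le T j n))
  gcongr
  rw [← ofReal_norm, ← norm_propagator (-t), ofReal_norm]
  exact enorm_le_normU2 hn fun t => propagator (-t) (lpProj j (f t))

end Windows

section Measurability

theorem aestronglyMeasurable_coeff_of_blockEnergy_ne_top {T : ℝ} (hT : 0 < T) {f : ℝ → Coeffs}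
    (hf : ∀ j, blockEnergy normU2ZK T f j ≠ ⊤) (k : Fin 2 → ℤ) :
    AEStronglyMeasurable (fun t => f t k) (volume.restrict (Ico 0 T)) := by
  obtain ⟨j, hj⟩ := exists_mem_annulus k
  have hcover : Ico 0 T ⊆ ⋃ n, Ico (windowStart T j n) (windowStart T j n + window T j) :=
    fun t ht => mem_iUnion.2 (exists_mem_Ico_windowStart ht j)
  refine AEStronglyMeasurable.mono_measure ?_ (Measure.restrict_mono hcover le_rfl)
  rw [aestronglyMeasurable_iUnion_iff]
  intro n
  have hfin : normU2ZK (windowStart T j n) (windowStart T j n + window T j)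
      (fun t => lpProj j (f t)) ≠ ⊤ := by
    intro htop
    have hle := sq_le_blockEnergy (X := normU2ZK) (f := f) (windowStart_nonneg hT j n)
      (windowStart_add_window_le T j n)
    rw [htop, ENNReal.top_pow two_ne_zero] at hle
    exact hf j (top_unique hle)
  have continuous_coeff : Continuous fun g : L2 => mFourierBasis.repr g k := by
    simp_rw [HilbertBasis.repr_apply_apply]
    exact continuous_const.inner continuous_id
  have continuous_exp : Continuous fun t : ℝ => Complex.exp (Complex.I * ((t * phase k : ℝ) : ℂ)) :=
    by fun_prop
  refine (continuous_exp.aestronglyMeasurable.mul (continuous_coeff.comp_aestronglyMeasurable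
    (aestronglyMeasurable_of_normU2_ne_top hfin))).congr (Eventually.of_forall fun t => ?_)
  simp only [Pi.mul_apply]
  rw [repr_propagator, repr_lpProj, indicator_of_mem hj, ← mul_assoc, ← Complex.exp_add]
  simp

variable {μ : Measure ℝ}

theorem aestronglyMeasurable_dxMul {u v : ℝ → L2}
    (hu : ∀ k, AEStronglyMeasurable (fun t => mFourierCoeff (u t) k) μ)
    (hv : ∀ k, AEStronglyMeasurable (fun t => mFourierCoeff (v t) k) μ) (k : Fin 2 → ℤ) :
    AEStronglyMeasurable (fun t => dxMul (u t) (v t) k) μ := by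
  refine AEStronglyMeasurable.const_mul ?_ _
  exact aestronglyMeasurable_of_tendsto_ae (atTop : Filter (Finset (Fin 2 → ℤ)))
    (fun s => Finset.aestronglyMeasurable_fun_sum s fun m _ => (hu (k - m)).mul (hv m))
    (Eventually.of_forall fun t => hasSum_mFourierCoeff_mul (u t) (v t) k)

theorem aestronglyMeasurable_propagator_lpProj {f : ℝ → Coeffs}
    (hf : ∀ k, AEStronglyMeasurable (fun t => f t k) μ) (j : ℕ) :
    AEStronglyMeasurable (fun t => propagator (-t) (lpProj j (f t))) μ := by
  simp_rw [propagator_lpProj, lpProj]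
  refine Finset.aestronglyMeasurable_fun_sum _ fun k _ => ?_
  have continuous_exp : Continuous fun t : ℝ =>
      Complex.exp (Complex.I * ((-t * phase k : ℝ) : ℂ)) := by fun_prop
  exact (continuous_exp.aestronglyMeasurable.mul (hf k)).smul_const _

end Measurability

section Bilinear

variable {T t : ℝ} (u v : ℝ → L2)

theorem enorm_lpProj_dxMul_sq_le_blockEnergy (ht : t ∈ Ico 0 T) (J : ℕ) :
    ‖lpProj J (dxMul (u t) (v t))‖ₑ ^ 2 ≤ 100 * 16 ^ J *
      convBound (blockEnergy normU2ZK T fun t => mFourierCoeff (u t))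
        (blockEnergy normU2ZK T fun t => mFourierCoeff (v t)) J := by
  refine (enorm_lpProj_dxMul_sq_le (u t) (v t) J).trans ?_
  gcongr
  exact convBound_mono (enorm_lpProj_sq_le_blockEnergy ht fun t => mFourierCoeff (u t))
    (enorm_lpProj_sq_le_blockEnergy ht fun t => mFourierCoeff (v t)) J

variable {u v} in
theorem aestronglyMeasurable_propagator_lpProj_dxMul (hT : 0 < T) {σ s : ℝ}
    (huv : normF T σ u * normF T s v ≠ ⊤) (J : ℕ) :
    AEStronglyMeasurable (fun t => propagator (-t) (lpProj J (dxMul (u t) (v t))))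
      (volume.restrict (Ico 0 T)) := by
  by_cases hzero : normF T σ u = 0 ∨ normF T s v = 0
  · have hbound : convBound (blockEnergy normU2ZK T fun t => mFourierCoeff (u t))
        (blockEnergy normU2ZK T fun t => mFourierCoeff (v t)) J = 0 := by
      rcases hzero with h | h <;> simp [convBound, blockEnergy_eq_zero h]
    refine (aestronglyMeasurable_const (b := (0 : L2))).congr
      ((ae_restrict_iff' measurableSet_Ico).2 (Eventually.of_forall fun t ht => ?_))
    have h := enorm_lpProj_dxMul_sq_le_blockEnergy u v ht J
    rw [hbound, mul_zero, nonpos_iff_eq_zero, pow_eq_zero_iff two_ne_zero, enorm_eq_zero] at h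
    rw [eq_comm, ← norm_eq_zero, norm_propagator, h, norm_zero]
  · push Not at hzero
    have hu : normF T σ u ≠ ⊤ := fun h => huv (by rw [h, ENNReal.top_mul hzero.2])
    have hv : normF T s v ≠ ⊤ := fun h => huv (by rw [h, ENNReal.mul_top hzero.1])
    exact aestronglyMeasurable_propagator_lpProj (aestronglyMeasurable_dxMul
      (aestronglyMeasurable_coeff_of_blockEnergy_ne_top hT (blockEnergy_ne_top hu))
      (aestronglyMeasurable_coeff_of_blockEnergy_ne_top hT (blockEnergy_ne_top hv))) J

theorem normDU2ZK_sq_le {a b : ℝ} (hab : a < b) {f : ℝ → L2} {Q : ℝ≥0∞}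
    (hf : AEStronglyMeasurable (fun t => propagator (-t) (f t)) (volume.restrict (Ico a b)))
    (hQ : ∀ t ∈ Ico a b, ‖f t‖ₑ ^ 2 ≤ Q) :
    normDU2ZK a b f ^ 2 ≤ 64 * Q * ENNReal.ofReal (b - a) ^ 2 := by
  have hsup : eLpNorm (fun t => propagator (-t) (f t)) ∞ (volume.restrict (Ico a b)) ≤
      Q ^ (2⁻¹ : ℝ) := by
    rw [eLpNorm_exponent_top]
    refine eLpNormEssSup_le_of_ae_enorm_bound
      ((ae_restrict_iff' measurableSet_Ico).2 (Eventually.of_forall fun t ht => ?_))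
    rw [← ofReal_norm, norm_propagator, ofReal_norm, ENNReal.le_rpow_inv_iff two_pos,
      ENNReal.rpow_two]
    exact hQ t ht
  calc normDU2ZK a b f ^ 2 ≤ (8 * Q ^ (2⁻¹ : ℝ) * ENNReal.ofReal (b - a)) ^ 2 := by
        gcongr
        exact (normDU2_le_eLpNorm_top hab hf).trans (by gcongr)
    _ = 64 * Q * ENNReal.ofReal (b - a) ^ 2 := by
        rw [mul_pow, mul_pow, ← ENNReal.rpow_two (Q ^ _), ENNReal.rpow_inv_rpow two_ne_zero]
        norm_num

theorem blockEnergy_dxMul_le (hT : 0 < T) {J : ℕ}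
    (hm : AEStronglyMeasurable (fun t => propagator (-t) (lpProj J (dxMul (u t) (v t))))
      (volume.restrict (Ico 0 T))) :
    blockEnergy normDU2ZK T (fun t => dxMul (u t) (v t)) J ≤
      6400 * convBound (blockEnergy normU2ZK T fun t => mFourierCoeff (u t))
        (blockEnergy normU2ZK T fun t => mFourierCoeff (v t)) J := by
  refine blockEnergy_le fun a ha haT => ?_
  have hsub : Ico a (a + window T J) ⊆ Ico 0 T := Ico_subset_Ico ha haT
  set Q := convBound (blockEnergy normU2ZK T fun t => mFourierCoeff (u t))
    (blockEnergy normU2ZK T fun t => mFourierCoeff (v t)) J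
  calc normDU2ZK a (a + window T J) (fun t => lpProj J (dxMul (u t) (v t))) ^ 2
      ≤ 64 * (100 * 16 ^ J * Q) * ENNReal.ofReal (a + window T J - a) ^ 2 :=
        normDU2ZK_sq_le (lt_add_of_pos_right a (window_pos hT J))
          (hm.mono_measure (Measure.restrict_mono hsub le_rfl))
          fun t ht => enorm_lpProj_dxMul_sq_le_blockEnergy u v (hsub ht) J
    _ = 6400 * Q * (ENNReal.ofReal (window T J) ^ 2 * 16 ^ J) := by
        rw [add_sub_cancel_left]
        ring
    _ ≤ 6400 * Q := mul_le_of_le_one_right' (ofReal_window_sq_mul_le T J)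

/-- The constant of the bilinear estimate; its dependence on `s` is that of the sum of a geometric
series with ratio `q⁻¹ = 2 ^ (-2 * s)`. -/
noncomputable def bilinearConst (s : ℝ) : ℝ≥0∞ :=
  let q := ENNReal.ofReal (2 ^ (2 * s))
  (6400 * (2 * (q * (1 - q⁻¹)⁻¹ + 3 * q))) ^ (1 / 2 : ℝ)

theorem bilinearConst_ne_top {s : ℝ} (hs : 0 < s) : bilinearConst s ≠ ⊤ := by
  have one_lt_q : 1 < ENNReal.ofReal (2 ^ (2 * s)) := by
    rw [ENNReal.one_lt_ofReal]
    exact Real.one_lt_rpow one_lt_two (by positivity)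
  have one_sub_ne_zero := (tsub_pos_of_lt (ENNReal.inv_lt_one.2 one_lt_q)).ne'
  unfold bilinearConst
  finiteness

theorem bilinearConst_pos (s : ℝ) : 0 < bilinearConst s := by
  have : 0 < ENNReal.ofReal (2 ^ (2 * s)) := ENNReal.ofReal_pos.2 (by positivity)
  unfold bilinearConst
  positivity

variable {u v} in
theorem normN_dxMul_le (hT : 0 < T) {σ s : ℝ} (hσ : 0 ≤ σ) (hσs : σ ≤ s)
    (huv : normF T σ u * normF T s v ≠ ⊤) :
    normN T σ (fun t => dxMul (u t) (v t)) ≤ bilinearConst s * (normF T σ u * normF T s v) := by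
  simp only [normN, normF, shortTimeNorm_eq, bilinearConst]
  set p := ENNReal.ofReal (2 ^ (2 * σ)) with hp
  set q := ENNReal.ofReal (2 ^ (2 * s)) with hq
  have one_le_p : 1 ≤ p := by
    rw [hp, ENNReal.one_le_ofReal]
    exact Real.one_le_rpow one_le_two (by positivity)
  have p_le_q : p ≤ q := by
    rw [hp, hq]
    gcongr
    exact one_le_two
  rw [← ENNReal.mul_rpow_of_nonneg _ _ (by norm_num),
    ← ENNReal.mul_rpow_of_nonneg _ _ (by norm_num)]
  refine ENNReal.rpow_le_rpow ?_ (by norm_num)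
  set α := blockEnergy normU2ZK T fun t => mFourierCoeff (u t)
  set β := blockEnergy normU2ZK T fun t => mFourierCoeff (v t)
  calc ∑' J, p ^ J * blockEnergy normDU2ZK T (fun t => dxMul (u t) (v t)) J
      ≤ ∑' J, p ^ J * (6400 * convBound α β J) := by
        gcongr with J
        exact blockEnergy_dxMul_le u v hT (aestronglyMeasurable_propagator_lpProj_dxMul hT huv J)
    _ = 6400 * ∑' J, p ^ J * convBound α β J := by
        rw [← ENNReal.tsum_mul_left]
        exact tsum_congr fun J => mul_left_comm _ _ _
    _ ≤ 6400 * (2 * (q * (1 - q⁻¹)⁻¹ + 3 * q) *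
          ((∑' j, p ^ j * α j) * ∑' l, q ^ l * β l)) := by
        gcongr
        exact tsum_pow_mul_convBound_le one_le_p p_le_q ENNReal.ofReal_ne_top α β
    _ = _ := (mul_assoc _ _ _).symm

end Bilinear

end ZK

theorem mainTheorem6_general {s : ℝ} (hs : 0 < s) :
    ∃ C : ℝ≥0, ∀ σ, 0 ≤ σ → σ ≤ s → ∀ T, 0 < T → ∀ u v : ℝ → ZK.L2,
      ZK.normN T σ (fun t => ZK.dxMul (u t) (v t)) ≤ C * (ZK.normF T σ u * ZK.normF T s v) := by
  refine ⟨(ZK.bilinearConst s).toNNReal, fun σ hσ hσs T hT u v => ?_⟩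
  rw [ENNReal.coe_toNNReal (ZK.bilinearConst_ne_top hs)]
  by_cases huv : ZK.normF T σ u * ZK.normF T s v = ⊤
  · rw [huv, ENNReal.mul_top (ZK.bilinearConst_pos s).ne']
    exact le_top
  · exact ZK.normN_dxMul_le hT hσ hσs huv

theorem mainTheorem6 (s : ℝ) (hs : 0 < s) :
    ∃ C : NNReal, ∀ T : ℝ, 0 < T → T ≤ 1 → ∀ u v : ℝ → ZK.L2,
      ZK.normN T s (fun t => ZK.dxMul (u t) (v t)) ≤ C * (ZK.normF T s u * ZK.normF T s v) ∧
      ZK.normN T 0 (fun t => ZK.dxMul (u t) (v t)) ≤ C * (ZK.normF T 0 u * ZK.normF T s v) := by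
  obtain ⟨C, hC⟩ := mainTheorem6_general hs
  exact ⟨C, fun T hT _ u v => ⟨hC s hs.le le_rfl T hT u v, hC 0 le_rfl hs.le T hT u v⟩⟩
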